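/- For a finite $2$-group $G$ of order $2^n$ and an integer $k$ with $0 \le k \le n$, let $s_k(G)$ denote the number of subgroups of $G$ of order $2^k$. Let $D_8$ denote the dihedral group of order $8$ and let $C_2^m$ denote the elementary abelian $2$-group of order $2^m$. Let $G$ be a finite group of order $2^n$, $n \ge 3$, that is not elementary abelian (that is, $G$ is not an abelian group all of whose elements $x$ satisfy $x^2 = 1$). Then $$s_k(G) \le s_k\bigl(D_8 \times C_2^{\,n-3}\bigr) \qquad \text{for all } 0 \le k \le n.$$ -/

import Mathlib

/-- The elementary abelian group `C_2 ^ m`, written multiplicatively. -/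
abbrev ElemAbTwo (m : ℕ) : Type := Fin m → Multiplicative (ZMod 2)

/-- `G` is an elementary abelian `p`-group: it is abelian and every element `x` satisfies
`x ^ p = 1`. -/
def IsElemAbelian (p : ℕ) (G : Type*) [Group G] : Prop :=
  (∀ x y : G, x * y = y * x) ∧ ∀ x : G, x ^ p = 1

/-- The number `s_k(G)` of subgroups of order `p ^ k` of `G` (meant for finite `G`). -/
noncomputable def numSubgroups (p : ℕ) (G : Type*) [Group G] (k : ℕ) : ℕ :=
  Nat.card {H : Subgroup G // Nat.card H = p ^ k}

/-! Let s_k and e_k count all, respectively all elementary abelian, subgroups of order 2^k. Let z be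
a central involution and Q = G/⟨z⟩. Subgroups containing z correspond to subgroups of Q. Those
avoiding z with a given image K number at most |Hom(K, C_2)|, which is |K| if K is elementary
abelian and at most |K|/2 otherwise. Hence s_{k+1}(G) ≤ s_k(Q) + 2^k (s_{k+1}(Q) + e_{k+1}(Q)) and
e_{k+1}(G) ≤ e_k(Q) + 2^{k+1} e_{k+1}(Q) (`numSubgroups_succ_le`, `numElemAb_succ_le`). Both are
reversed for G = Q × C_2 when the squares of Q lie in a normal subgroup of order at most 2
(`le_numSubgroups_prod`, `le_numElemAb_prod`), so D_8 × C_2^m reaches the bounds.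

If some such Q is not elementary abelian, both bounds follow together by induction. Otherwise z is
the only central involution, and the elementary abelian subgroups containing z are double counted
against noncentral involutions (`numElemAbOver_succ_le_maxElemAb`).

The formula `maxElemAb` is inclusion-exclusion: in D_8 × C_2^{n-3} every elementary abelian subgroup
lies in one of two such subgroups of index 2, which meet in index 4. The formula `maxSubgroups`
separates the subgroups that contain the commutator subgroup of order 2 from its complements in
elementary abelian subgroups. -/

/-! ### Homomorphisms to a group of order 2. -/

theorem card_monoidHom_units_of_mul_self {K : Type*} [Group K] [Finite K]
    (h : ∀ x : K, x * x = 1) : Nat.card (K →* ℤˣ) = Nat.card K := by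
  let _ : CommGroup K :=
    { ‹Group K› with
      mul_comm := fun a b => by
        have h1 := h (a * b)
        have ha : a⁻¹ = a := inv_eq_of_mul_eq_one_left (h a)
        have hb : b⁻¹ = b := inv_eq_of_mul_eq_one_left (h b)
        have hab : (a * b)⁻¹ = a * b := inv_eq_of_mul_eq_one_left h1
        rw [mul_inv_rev, ha, hb] at hab
        exact hab.symm }
  -- Since ±1 are the square roots of unity in ℤ, duality for finite abelian groups of exponent
  -- dividing 2 works over ℤ.
  have h2 : HasEnoughRootsOfUnity ℤ 2 :=
    { prim := ⟨-1, by simpa using IsPrimitiveRoot.neg_one (R := ℤ) 0 (by norm_num)⟩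
      cyc := inferInstance }
  have hdvd : Monoid.exponent K ∣ 2 :=
    Monoid.exponent_dvd_of_forall_pow_eq_one fun x => by rw [pow_two, h x]
  have := HasEnoughRootsOfUnity.of_dvd ℤ hdvd
  exact CommGroup.card_monoidHom_of_hasEnoughRootsOfUnity K ℤ

/-- The normal closure of the set of squares. -/
def squareClosure (K : Type*) [Group K] : Subgroup K :=
  Subgroup.normalClosure {x | ∃ y : K, x = y * y}

instance squareClosure_normal (K : Type*) [Group K] : (squareClosure K).Normal :=
  Subgroup.normalClosure_normal

theorem mul_self_mem_squareClosure {K : Type*} [Group K] (y : K) :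
    y * y ∈ squareClosure K :=
  Subgroup.subset_normalClosure ⟨y, rfl⟩

/-- Homomorphisms to ±1 kill squares, so they factor through a quotient of exponent at most 2, which
has as many characters as elements. -/
theorem card_monoidHom_units {K : Type*} [Group K] [Finite K] :
    Nat.card (K →* ℤˣ) = (squareClosure K).index := by
  have hker : ∀ χ : K →* ℤˣ, squareClosure K ≤ χ.ker := fun χ =>
    Subgroup.normalClosure_le_normal (by
      rintro _ ⟨y, rfl⟩
      simp [MonoidHom.mem_ker, Int.units_mul_self])
  have e : (K →* ℤˣ) ≃ (K ⧸ squareClosure K →* ℤˣ) :=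
    { toFun := fun χ => QuotientGroup.lift _ χ (hker χ)
      invFun := fun χ => χ.comp (QuotientGroup.mk' _)
      left_inv := fun χ => by ext x; simp
      right_inv := fun χ => by ext x; simp }
  rw [Nat.card_congr e, card_monoidHom_units_of_mul_self, Subgroup.index]
  intro x
  induction x using QuotientGroup.induction_on with
  | H y =>
    rw [← QuotientGroup.mk_mul, QuotientGroup.eq_one_iff]
    exact mul_self_mem_squareClosure y

theorem card_monoidHom_units_le {K : Type*} [Group K] [Finite K] :
    Nat.card (K →* ℤˣ) ≤ Nat.card K := by
  rw [card_monoidHom_units]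
  exact Nat.le_of_dvd Nat.card_pos (Subgroup.index_dvd_card _)

theorem two_mul_card_monoidHom_units_le {K : Type*} [Group K] [Finite K]
    (h : ¬ ∀ x : K, x * x = 1) : 2 * Nat.card (K →* ℤˣ) ≤ Nat.card K := by
  rw [card_monoidHom_units, ← (squareClosure K).card_mul_index]
  refine Nat.mul_le_mul_right _ ?_
  push Not at h
  obtain ⟨x, hx⟩ := h
  have hnt : Nontrivial (squareClosure K) :=
    (Subgroup.nontrivial_iff_exists_ne_one _).2 ⟨_, mul_self_mem_squareClosure x, hx⟩
  exact Finite.one_lt_card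

theorem card_le_two_mul_card_monoidHom_units {K : Type*} [Group K] [Finite K]
    (N : Subgroup K) [N.Normal] (hN : Nat.card N ≤ 2) (h : ∀ x : K, x * x ∈ N) :
    Nat.card K ≤ 2 * Nat.card (K →* ℤˣ) := by
  rw [card_monoidHom_units, ← (squareClosure K).card_mul_index]
  refine Nat.mul_le_mul_right _ (le_trans ?_ hN)
  refine Subgroup.card_le_of_le (Subgroup.normalClosure_le_normal ?_)
  rintro _ ⟨y, rfl⟩
  exact h y

/-! ### Subgroups of a central extension by a group of order 2. -/

/-- A subgroup meeting the kernel trivially is the range of a section over its image. -/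
theorem exists_section {G Q : Type*} [Group G] [Group Q] (f : G →* Q) (H : Subgroup G)
    (K : Subgroup Q) (hd : Disjoint H f.ker) (hm : H.map f = K) :
    ∃ s : K →* G, (∀ x, f (s x) = x) ∧ s.range = H := by
  subst hm
  have hinj : Function.Injective (f.subgroupMap H) := by
    rw [injective_iff_map_eq_one]
    intro a ha
    have : f a = 1 := congrArg Subtype.val ha
    exact Subtype.ext (Subgroup.disjoint_def.1 hd a.2 this)
  let e : H ≃* H.map f :=
    MulEquiv.ofBijective (f.subgroupMap H) ⟨hinj, f.subgroupMap_surjective H⟩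
  refine ⟨H.subtype.comp e.symm.toMonoidHom, fun x => ?_, ?_⟩
  · exact congrArg Subtype.val (e.apply_symm_apply x)
  · rw [MonoidHom.range_comp, MonoidHom.range_eq_top.2 e.symm.surjective,
      ← MonoidHom.range_eq_map, Subgroup.range_subtype]

/-- Each such subgroup is the range of a section over K. Because the kernel is central, the quotient
of two sections is a homomorphism from K to the kernel. -/
theorem card_complements_le {G Q : Type*} [Group G] [Group Q] [Finite G] [Finite Q] (f : G →* Q)
    (hc : f.ker ≤ Subgroup.center G) (h2 : Nat.card f.ker = 2) (K : Subgroup Q) :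
    {H : Subgroup G | Disjoint H f.ker ∧ H.map f = K}.ncard ≤ Nat.card (K →* ℤˣ) := by
  rcases Set.eq_empty_or_nonempty {H : Subgroup G | Disjoint H f.ker ∧ H.map f = K} with he | hne
  · simp [he]
  obtain ⟨H₀, hd₀, hm₀⟩ := hne
  obtain ⟨s₀, hs₀, -⟩ := exists_section f H₀ K hd₀ hm₀
  have hcardK : Nat.card (K →* f.ker) = Nat.card (K →* ℤˣ) := by
    have : Fact (Nat.Prime 2) := ⟨Nat.prime_two⟩
    have e : f.ker ≃* ℤˣ := mulEquivOfPrimeCardEq (p := 2) h2 (by simp)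
    exact Nat.card_congr ⟨fun χ => e.toMonoidHom.comp χ, fun χ => e.symm.toMonoidHom.comp χ,
      fun χ => by ext; simp, fun χ => by ext; simp⟩
  rw [← hcardK, ← Nat.card_coe_set_eq]
  choose s hs hr using fun H : {H : Subgroup G | Disjoint H f.ker ∧ H.map f = K} =>
    exists_section f H.1 K H.2.1 H.2.2
  have hmem : ∀ H x, s H x * (s₀ x)⁻¹ ∈ f.ker := fun H x => by
    simp [MonoidHom.mem_ker, hs, hs₀]
  let φ : {H : Subgroup G | Disjoint H f.ker ∧ H.map f = K} → (K →* f.ker) := fun H =>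
    { toFun := fun x => ⟨s H x * (s₀ x)⁻¹, hmem H x⟩
      map_one' := by ext; simp
      map_mul' := fun x y => by
        ext
        have := Subgroup.mem_center_iff.1 (hc (hmem H y)) (s₀ x)⁻¹
        simp only [map_mul, mul_inv_rev, Subgroup.coe_mul]
        calc s H x * s H y * ((s₀ y)⁻¹ * (s₀ x)⁻¹)
            = s H x * (s H y * (s₀ y)⁻¹ * (s₀ x)⁻¹) := by group
          _ = s H x * (s₀ x)⁻¹ * (s H y * (s₀ y)⁻¹) := by rw [← this]; group }
  have : Finite (K →* f.ker) := Finite.of_injective _ DFunLike.coe_injective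
  refine Nat.card_le_card_of_injective φ fun H H' hHH => ?_
  have : s H = s H' := by
    ext x
    have := congrArg Subtype.val (DFunLike.congr_fun hHH x)
    exact mul_right_cancel this
  apply Subtype.ext
  rw [← hr H, ← hr H', this]

theorem ncard_le_sum_card_monoidHom {G Q : Type*} [Group G] [Group Q] [Finite G] [Finite Q]
    (f : G →* Q) (hc : f.ker ≤ Subgroup.center G) (h2 : Nat.card f.ker = 2)
    (A : Set (Subgroup G)) (B : Finset (Subgroup Q)) (hA : ∀ H ∈ A, Disjoint H f.ker)
    (hAB : ∀ H ∈ A, H.map f ∈ B) :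
    A.ncard ≤ ∑ K ∈ B, Nat.card (K →* ℤˣ) := by
  classical
  have hfin : A.Finite := Set.toFinite A
  rw [Set.ncard_eq_toFinset_card A hfin,
    Finset.card_eq_sum_card_fiberwise (f := fun H : Subgroup G => H.map f) (t := B)
      (fun H hH => hAB H (by simpa using hH))]
  refine Finset.sum_le_sum fun K _ => le_trans ?_ (card_complements_le f hc h2 K)
  rw [← Set.ncard_coe_finset]
  refine Set.ncard_le_ncard ?_ (Set.toFinite _)
  intro H hH
  simp only [Finset.coe_filter, Set.Finite.mem_toFinset, Set.mem_ofPred_eq] at hH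
  exact ⟨hA H hH.1, hH.2⟩

/-- The number of subgroups of order `2 ^ k` all of whose elements square to `1`. -/
noncomputable def numElemAb (G : Type*) [Group G] (k : ℕ) : ℕ :=
  {H : Subgroup G | Nat.card H = 2 ^ k ∧ ∀ x ∈ H, x * x = 1}.ncard

/-- The number of subgroups of order `2 ^ (k + 1)` containing the kernel of `f`, all of whose
elements square to `1`. -/
noncomputable def numElemAbOver {G Q : Type*} [Group G] [Group Q] (f : G →* Q) (k : ℕ) : ℕ :=
  {H : Subgroup G | Nat.card H = 2 ^ (k + 1) ∧ f.ker ≤ H ∧ ∀ x ∈ H, x * x = 1}.ncard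

theorem numSubgroups_eq_ncard (G : Type*) [Group G] (k : ℕ) :
    numSubgroups 2 G k = {H : Subgroup G | Nat.card H = 2 ^ k}.ncard :=
  Nat.card_coe_set_eq _

theorem numSubgroups_zero (G : Type*) [Group G] [Finite G] : numSubgroups 2 G 0 = 1 := by
  rw [numSubgroups_eq_ncard, Set.ncard_eq_one]
  exact ⟨⊥, by ext H; simp [Subgroup.card_eq_one]⟩

theorem numElemAb_zero (G : Type*) [Group G] [Finite G] : numElemAb G 0 = 1 := by
  rw [numElemAb, Set.ncard_eq_one]
  refine ⟨⊥, ?_⟩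
  ext H
  simp only [pow_zero, Subgroup.card_eq_one, Set.mem_ofPred_eq, Set.mem_singleton_iff]
  constructor
  · exact fun h => h.1
  · rintro rfl
    simp [Subgroup.mem_bot]

section CentralExtension

variable {G Q : Type*} [Group G] [Group Q] {f : G →* Q}

theorem card_ker_subgroupOf_mul_card_map (f : G →* Q) (H : Subgroup G) :
    Nat.card (f.ker.subgroupOf H) * Nat.card (H.map f) = Nat.card H := by
  rw [← Subgroup.relIndex_ker, Subgroup.relIndex, Subgroup.card_mul_index]

theorem disjoint_or_ker_le (h2 : Nat.card f.ker = 2) (H : Subgroup G) :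
    Disjoint H f.ker ∨ f.ker ≤ H := by
  have : Fact (Nat.card f.ker).Prime := ⟨h2 ▸ Nat.prime_two⟩
  rcases Subgroup.eq_bot_or_eq_top_of_prime_card (H.subgroupOf f.ker) with h | h
  · exact Or.inl (Subgroup.subgroupOf_eq_bot.1 h)
  · exact Or.inr (Subgroup.subgroupOf_eq_top.1 h)

theorem injOn_map_of_ker_le : Set.InjOn (fun H : Subgroup G => H.map f) {H | f.ker ≤ H} := by
  intro H hH H' hH' h
  rw [← Subgroup.comap_map_eq_self (f := f) hH, ← Subgroup.comap_map_eq_self (f := f) hH']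
  exact congrArg (Subgroup.comap f) h

theorem mul_self_eq_one_of_mem_ker (h2 : Nat.card f.ker = 2) {x : G} (hx : x ∈ f.ker) :
    x * x = 1 := by
  have := pow_card_eq_one' (G := f.ker) (x := ⟨x, hx⟩)
  rw [h2, pow_two] at this
  exact congrArg Subtype.val this

theorem card_map_of_disjoint {H : Subgroup G} (hd : Disjoint H f.ker) :
    Nat.card (H.map f) = Nat.card H := by
  rw [← card_ker_subgroupOf_mul_card_map f H, Subgroup.subgroupOf_eq_bot.2 hd.symm]
  simp

theorem card_map_of_ker_le (h2 : Nat.card f.ker = 2) {H : Subgroup G} (hd : f.ker ≤ H) :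
    2 * Nat.card (H.map f) = Nat.card H := by
  rw [← card_ker_subgroupOf_mul_card_map f H,
    Nat.card_congr (Subgroup.subgroupOfEquivOfLe hd).toEquiv, h2]

theorem card_map_eq_two_pow (h2 : Nat.card f.ker = 2) {H : Subgroup G} (hd : f.ker ≤ H) {k : ℕ}
    (hk : Nat.card H = 2 ^ (k + 1)) : Nat.card (H.map f) = 2 ^ k := by
  have := card_map_of_ker_le h2 hd
  rw [hk, pow_succ] at this
  omega

variable [Finite Q]

theorem ncard_ker_le_le (h2 : Nat.card f.ker = 2) (k : ℕ) :
    {H : Subgroup G | Nat.card H = 2 ^ (k + 1) ∧ f.ker ≤ H}.ncard ≤ numSubgroups 2 Q k := by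
  rw [numSubgroups_eq_ncard]
  refine Set.ncard_le_ncard_of_injOn (fun H => H.map f) ?_ ?_ (Set.toFinite _)
  · exact fun H hH => card_map_eq_two_pow h2 hH.2 hH.1
  · exact injOn_map_of_ker_le.mono fun H hH => hH.2

theorem numElemAbOver_le (h2 : Nat.card f.ker = 2) (k : ℕ) :
    numElemAbOver f k ≤ numElemAb Q k := by
  refine Set.ncard_le_ncard_of_injOn (fun H => H.map f) ?_ ?_ (Set.toFinite _)
  · rintro H ⟨hk, hle, hH⟩
    refine ⟨card_map_eq_two_pow h2 hle hk, ?_⟩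
    rintro _ ⟨x, hx, rfl⟩
    rw [← map_mul, hH x hx, map_one]
  · exact injOn_map_of_ker_le.mono fun H hH => hH.2.1

variable [Finite G]

/-- If H avoids the central kernel and is elementary abelian, so is the product of H and the kernel,
the full preimage of the image of H. Each such preimage arises from at most 2^k subgroups H. -/
theorem ncard_avoiding_elemAb_le (hs : Function.Surjective f) (hc : f.ker ≤ Subgroup.center G)
    (h2 : Nat.card f.ker = 2) (k : ℕ) :
    {H : Subgroup G | Nat.card H = 2 ^ k ∧ Disjoint H f.ker ∧ ∀ x ∈ H, x * x = 1}.ncard ≤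
      2 ^ k * numElemAbOver f k := by
  have hfin : {K : Subgroup Q | Nat.card K = 2 ^ k ∧ ∀ x ∈ K.comap f, x * x = 1}.Finite :=
    Set.toFinite _
  refine (ncard_le_sum_card_monoidHom f hc h2 _ hfin.toFinset (fun H hH => hH.2.1) ?_).trans ?_
  · rintro H ⟨hk, hd, hH⟩
    rw [Set.Finite.mem_toFinset]
    refine ⟨by rw [card_map_of_disjoint hd, hk], ?_⟩
    rintro x ⟨h, hh, hx⟩
    have hn : h⁻¹ * x ∈ f.ker := by simp [MonoidHom.mem_ker, hx]
    have hcomm := Subgroup.mem_center_iff.1 (hc hn) h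
    calc x * x = h * (h⁻¹ * x) * (h * (h⁻¹ * x)) := by group
      _ = (h * h) * ((h⁻¹ * x) * (h⁻¹ * x)) :=
        Commute.mul_mul_mul_comm hcomm.symm _ _
      _ = 1 := by rw [hH h hh, mul_self_eq_one_of_mem_ker h2 hn, one_mul]
  · have hcard : hfin.toFinset.card ≤ numElemAbOver f k := by
      rw [← Set.ncard_eq_toFinset_card _ hfin]
      refine Set.ncard_le_ncard_of_injOn (fun K => K.comap f) ?_ ?_ (Set.toFinite _)
      · rintro K ⟨hk, hK⟩
        have hle : f.ker ≤ K.comap f := Subgroup.ker_le_comap ..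
        refine ⟨?_, hle, hK⟩
        rw [← card_map_of_ker_le h2 hle, Subgroup.map_comap_eq_self_of_surjective hs, hk, pow_succ']
      · exact (Subgroup.comap_injective hs).injOn
    refine (Finset.sum_le_card_nsmul _ _ (2 ^ k) fun K hK => ?_).trans ?_
    · rw [Set.Finite.mem_toFinset] at hK
      exact hK.1 ▸ card_monoidHom_units_le
    · rw [smul_eq_mul, mul_comm]
      exact Nat.mul_le_mul_left _ hcard

theorem numElemAb_succ_le (hs : Function.Surjective f) (hc : f.ker ≤ Subgroup.center G)
    (h2 : Nat.card f.ker = 2) (k : ℕ) :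
    numElemAb G (k + 1) ≤ numElemAbOver f k + 2 ^ (k + 1) * numElemAbOver f (k + 1) := by
  refine le_trans (Set.ncard_le_ncard ?_ (Set.toFinite _)) ((Set.ncard_union_le _ _).trans
    (Nat.add_le_add_left (ncard_avoiding_elemAb_le hs hc h2 (k + 1)) _))
  rintro H ⟨hk, hH⟩
  rcases disjoint_or_ker_le h2 H with h | h
  · exact Or.inr ⟨hk, h, hH⟩
  · exact Or.inl ⟨hk, h, hH⟩

theorem numSubgroups_succ_le_add_avoiding (h2 : Nat.card f.ker = 2) (k : ℕ) :
    numSubgroups 2 G (k + 1) ≤ numSubgroups 2 Q k +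
      {H : Subgroup G | Nat.card H = 2 ^ (k + 1) ∧ Disjoint H f.ker}.ncard := by
  rw [numSubgroups_eq_ncard G]
  refine le_trans (Set.ncard_le_ncard ?_ (Set.toFinite _)) ((Set.ncard_union_le _ _).trans
    (Nat.add_le_add_right (ncard_ker_le_le h2 k) _))
  intro H hk
  rcases disjoint_or_ker_le h2 H with h | h
  · exact Or.inr ⟨hk, h⟩
  · exact Or.inl ⟨hk, h⟩

/-- All squares of G lie in the kernel, so a subgroup avoiding the kernel is automatically
elementary abelian. -/
theorem numSubgroups_succ_le_of_elemAb (hs : Function.Surjective f)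
    (hc : f.ker ≤ Subgroup.center G) (h2 : Nat.card f.ker = 2) (hQ : ∀ x : Q, x * x = 1) (k : ℕ) :
    numSubgroups 2 G (k + 1) ≤
      numSubgroups 2 Q k + 2 ^ (k + 1) * numElemAbOver f (k + 1) := by
  refine (numSubgroups_succ_le_add_avoiding h2 k).trans (Nat.add_le_add_left
    (le_trans (Set.ncard_le_ncard ?_ (Set.toFinite _))
      (ncard_avoiding_elemAb_le hs hc h2 (k + 1))) _)
  rintro H ⟨hk, hd⟩
  refine ⟨hk, hd, fun x hx => Subgroup.disjoint_def.1 hd (H.mul_mem hx hx) ?_⟩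
  rw [MonoidHom.mem_ker, map_mul, hQ]

theorem numSubgroups_succ_le (hc : f.ker ≤ Subgroup.center G) (h2 : Nat.card f.ker = 2) (k : ℕ) :
    numSubgroups 2 G (k + 1) ≤
      numSubgroups 2 Q k + 2 ^ k * (numSubgroups 2 Q (k + 1) + numElemAb Q (k + 1)) := by
  classical
  have hfin : {K : Subgroup Q | Nat.card K = 2 ^ (k + 1)}.Finite := Set.toFinite _
  refine (numSubgroups_succ_le_add_avoiding h2 k).trans (Nat.add_le_add_left
    ((ncard_le_sum_card_monoidHom f hc h2 _ hfin.toFinset (fun H hH => hH.2) ?_).trans ?_) _)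
  · rintro H ⟨hk, hd⟩
    rw [Set.Finite.mem_toFinset]
    exact (card_map_of_disjoint hd).trans hk
  -- The indicator doubles |K|/2 = 2^k to |K| exactly for elementary abelian K; summing it over K
  -- yields `numElemAb`.
  · have hle : ∀ K ∈ hfin.toFinset, Nat.card (K →* ℤˣ) ≤
        2 ^ k * (1 + if ∀ x ∈ K, x * x = 1 then 1 else 0) := by
      intro K hK
      have hK' : Nat.card K = 2 ^ (k + 1) := hfin.mem_toFinset.1 hK
      split_ifs with h
      · exact card_monoidHom_units_le.trans (by rw [hK', pow_succ])
      · have := two_mul_card_monoidHom_units_le (K := K) fun h' =>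
          h fun x hx => congrArg Subtype.val (h' ⟨x, hx⟩)
        rw [hK', pow_succ] at this
        omega
    refine (Finset.sum_le_sum hle).trans (le_of_eq ?_)
    rw [← Finset.mul_sum, Finset.sum_add_distrib, Finset.sum_const, smul_eq_mul, mul_one,
      ← Finset.card_filter, numSubgroups_eq_ncard, Set.ncard_eq_toFinset_card _ hfin, numElemAb,
      ← Set.ncard_coe_finset (Finset.filter _ _)]
    congr 3
    ext K
    simp

end CentralExtension

/-! ### Arithmetic of the extremal counts. -/

/-- The Gaussian binomial coefficient at `q = 2`. -/
def gaussTwo : ℕ → ℕ → ℕ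
  | _, 0 => 1
  | 0, _ + 1 => 0
  | n + 1, k + 1 => gaussTwo n k + 2 ^ (k + 1) * gaussTwo n (k + 1)

/-- The maximal number of elementary abelian subgroups of order `2 ^ k` in a group of order
`2 ^ n` that is not elementary abelian. -/
def maxElemAb (n k : ℕ) : ℕ := 2 * gaussTwo (n - 1) k - gaussTwo (n - 2) k

/-- The maximal number of subgroups of order `2 ^ k` in a group of order `2 ^ n` that is not
elementary abelian. -/
def maxSubgroups (n : ℕ) : ℕ → ℕ
  | 0 => 1
  | k + 1 => gaussTwo (n - 1) k + 2 ^ (k + 1) * maxElemAb (n - 1) (k + 1)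

@[simp] theorem gaussTwo_zero_right (n : ℕ) : gaussTwo n 0 = 1 := by cases n <;> rfl

@[simp] theorem gaussTwo_zero_succ (k : ℕ) : gaussTwo 0 (k + 1) = 0 := rfl

theorem gaussTwo_succ_succ (n k : ℕ) :
    gaussTwo (n + 1) (k + 1) = gaussTwo n k + 2 ^ (k + 1) * gaussTwo n (k + 1) := rfl

theorem gaussTwo_le_succ (n k : ℕ) : gaussTwo n k ≤ gaussTwo (n + 1) k := by
  cases k with
  | zero => simp
  | succ k =>
    rw [gaussTwo_succ_succ]
    exact (Nat.le_mul_of_pos_left _ (by positivity)).trans (Nat.le_add_left _ _)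

theorem gaussTwo_mono (k : ℕ) : Monotone fun n => gaussTwo n k :=
  monotone_nat_of_le_succ fun n => gaussTwo_le_succ n k

/-- Both sides count pairs of a nonzero vector and a (k+1)-dimensional subspace containing it in an
(n+1)-dimensional space over the field of two elements. -/
theorem gaussTwo_absorb (n k : ℕ) :
    ((2 : ℤ) ^ (k + 1) - 1) * gaussTwo (n + 1) (k + 1) = (2 ^ (n + 1) - 1) * gaussTwo n k := by
  induction n generalizing k with
  | zero => cases k <;> simp [gaussTwo_succ_succ]
  | succ n ih =>
    have h := ih k
    have e := gaussTwo_succ_succ (n + 1) k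
    rw [e]
    push_cast
    cases k with
    | zero =>
      simp only [gaussTwo_zero_right] at h ⊢
      push_cast at h ⊢
      linear_combination 2 * h
    | succ k =>
      have h' := ih k
      have e' := gaussTwo_succ_succ n k
      zify at e'
      linear_combination (2 ^ (k + 2) : ℤ) * h + 2 * h' - 2 * (2 ^ (n + 1) - 1) * e'

theorem maxElemAb_cast (n k : ℕ) :
    (maxElemAb (n + 1) k : ℤ) = 2 * gaussTwo n k - gaussTwo (n - 1) k := by
  have h : gaussTwo (n - 1) k ≤ gaussTwo n k := gaussTwo_mono k (Nat.sub_le n 1)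
  rw [maxElemAb, Nat.cast_sub]
  · push_cast
    rfl
  · simp only [Nat.add_sub_cancel]
    exact h.trans (Nat.le_mul_of_pos_left _ two_pos)

@[simp] theorem maxElemAb_zero (n : ℕ) : maxElemAb n 0 = 1 := by simp [maxElemAb]

theorem maxElemAb_succ (n k : ℕ) :
    maxElemAb (n + 3) (k + 1) = maxElemAb (n + 2) k + 2 ^ (k + 1) * maxElemAb (n + 2) (k + 1) := by
  zify
  rw [maxElemAb_cast, maxElemAb_cast, maxElemAb_cast]
  have e := gaussTwo_succ_succ n k
  have e' := gaussTwo_succ_succ (n + 1) k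
  zify at e e'
  simp only [Nat.add_one_sub_one]
  linear_combination 2 * e' - e

/-- Only the bottom case can be strict: for n = k = 0 the sides are 1 and 2, as the formula
overestimates the single involution of C_4. -/
theorem le_maxElemAb_succ (n k : ℕ) :
    maxElemAb (n + 1) k + 2 ^ (k + 1) * maxElemAb (n + 1) (k + 1) ≤ maxElemAb (n + 2) (k + 1) := by
  cases n with
  | succ n => exact (maxElemAb_succ n k).ge
  | zero => rcases k with _ | _ | k <;> simp [maxElemAb, gaussTwo_succ_succ]

theorem maxSubgroups_succ (n k : ℕ) :
    maxSubgroups (n + 4) (k + 1) = maxSubgroups (n + 3) k +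
      2 ^ k * (maxSubgroups (n + 3) (k + 1) + maxElemAb (n + 3) (k + 1)) := by
  cases k with
  | zero =>
    simp [maxSubgroups, maxElemAb_succ]
    ring
  | succ k =>
    simp only [maxSubgroups, Nat.add_one_sub_one, maxElemAb_succ n, gaussTwo_succ_succ]
    ring

theorem le_maxSubgroups_succ (n k : ℕ) :
    maxSubgroups (n + 2) k + 2 ^ k * (maxSubgroups (n + 2) (k + 1) + maxElemAb (n + 2) (k + 1)) ≤
      maxSubgroups (n + 3) (k + 1) := by
  cases n with
  | succ n => exact (maxSubgroups_succ n k).ge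
  | zero =>
    rcases k with _ | _ | k <;> simp [maxSubgroups, maxElemAb, gaussTwo_succ_succ]

/-- This is the numerical inequality that closes the double count of pairs of an involution and an
elementary abelian subgroup. -/
theorem mul_gaussTwo_le_mul_maxElemAb (m k : ℕ) :
    (3 * (2 : ℤ) ^ m - 1) * gaussTwo m k ≤ (2 ^ (k + 1) - 1) * maxElemAb (m + 2) (k + 1) := by
  rw [maxElemAb_cast, Nat.add_sub_cancel]
  have h := gaussTwo_absorb m k
  have e := gaussTwo_succ_succ m k
  zify at e
  set X : ℤ := (gaussTwo m (k + 1) : ℤ)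
  set Y : ℤ := (gaussTwo m k : ℤ)
  set Z : ℤ := (gaussTwo (m + 1) (k + 1) : ℤ)
  have hY : 0 ≤ Y := Int.natCast_nonneg _
  have hk : (1 : ℤ) ≤ 2 ^ k := one_le_pow₀ (by norm_num)
  have hm : (0 : ℤ) < 2 ^ m := by positivity
  have h1 : 2 ^ k * ((2 ^ (k + 1) - 1) * X) = (2 ^ m - 2 ^ k) * Y := by
    rw [e] at h
    have : (2 : ℤ) * (2 ^ k * ((2 ^ (k + 1) - 1) * X)) = 2 * ((2 ^ m - 2 ^ k) * Y) := by
      linear_combination h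
    exact mul_left_cancel₀ two_ne_zero this
  -- After multiplication by 2^k this reduces to 2^m - 2^k ≤ 2^k (2^m - 1).
  have h2 : (2 ^ (k + 1) - 1) * X ≤ (2 ^ m - 1) * Y := by
    refine le_of_mul_le_mul_left ?_ (lt_of_lt_of_le one_pos hk)
    rw [h1]
    nlinarith [mul_nonneg (mul_nonneg (sub_nonneg.2 hk) hm.le) hY]
  have h3 : (2 ^ (k + 1) - 1) * (2 * Z - X) = 2 * ((2 ^ (m + 1) - 1) * Y) -
      (2 ^ (k + 1) - 1) * X := by rw [← h]; ring
  rw [h3, pow_succ]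
  linarith

/-! ### Central involutions and the Gaussian bound for all 2-groups. -/

theorem exists_central_quotient {G : Type*} [Group G] [Finite G] {z : G}
    (hz : z ∈ Subgroup.center G) (hz1 : z ≠ 1) (hz2 : z * z = 1) :
    ∃ (N : Subgroup G) (_ : N.Normal), (QuotientGroup.mk' N).ker ≤ Subgroup.center G ∧
      Nat.card (QuotientGroup.mk' N).ker = 2 ∧
      ∀ x, x ∈ (QuotientGroup.mk' N).ker ↔ x = 1 ∨ x = z := by
  have hle : Subgroup.zpowers z ≤ Subgroup.center G := by simpa using hz
  have hn : (Subgroup.zpowers z).Normal :=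
    ⟨fun n hn g => by
      have := Subgroup.mem_center_iff.1 (hle hn) g
      rw [this, mul_inv_cancel_right]
      exact hn⟩
  have ho : orderOf z = 2 := orderOf_eq_prime (by rw [pow_two, hz2]) hz1
  classical
  refine ⟨Subgroup.zpowers z, hn, ?_, ?_, ?_⟩
  · rwa [QuotientGroup.ker_mk']
  · rw [QuotientGroup.ker_mk', Nat.card_zpowers, ho]
  · intro x
    rw [QuotientGroup.ker_mk']
    constructor
    · intro hx
      rw [mem_zpowers_iff_mem_range_orderOf, ho] at hx
      simpa [Finset.range_add_one, eq_comm, or_comm] using hx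
    · rintro (rfl | rfl)
      · exact one_mem _
      · exact Subgroup.mem_zpowers _

theorem exists_central_involution {G : Type*} [Group G] {n : ℕ}
    (hG : Nat.card G = 2 ^ (n + 1)) : ∃ z ∈ Subgroup.center G, z ≠ 1 ∧ z * z = 1 := by
  have : Fact (Nat.Prime 2) := ⟨Nat.prime_two⟩
  have hfin : Finite G := Nat.finite_of_card_ne_zero (by rw [hG]; positivity)
  obtain ⟨k, hk, hc⟩ := IsPGroup.card_center_eq_prime_pow hG n.succ_pos
  obtain ⟨z, hz⟩ := exists_prime_orderOf_dvd_card' (G := Subgroup.center G) 2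
    (hc ▸ dvd_pow_self 2 hk.ne')
  refine ⟨z, z.2, ?_, ?_⟩
  · intro h
    have : z = 1 := Subtype.ext h
    simp [this] at hz
  · have := pow_orderOf_eq_one z
    rw [hz, pow_two] at this
    exact congrArg Subtype.val this

theorem two_mul_card_of_surjective {G Q : Type*} [Group G] [Group Q] {f : G →* Q}
    (hs : Function.Surjective f) (h2 : Nat.card f.ker = 2) : 2 * Nat.card Q = Nat.card G := by
  have := card_map_of_ker_le h2 (H := ⊤) le_top
  rwa [Subgroup.map_top_of_surjective f hs, Subgroup.card_top, Subgroup.card_top] at this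

theorem numElemAb_le_numSubgroups {G : Type*} [Group G] [Finite G] (k : ℕ) :
    numElemAb G k ≤ numSubgroups 2 G k := by
  rw [numSubgroups_eq_ncard]
  exact Set.ncard_le_ncard (fun H hH => hH.1) (Set.toFinite _)

theorem numSubgroups_eq_zero {G : Type*} [Group G] [Finite G] {k : ℕ}
    (h : Nat.card G < 2 ^ k) : numSubgroups 2 G k = 0 := by
  rw [numSubgroups_eq_ncard, Set.ncard_eq_zero (Set.toFinite _), Set.eq_empty_iff_forall_notMem]
  exact fun H hH => absurd (H.card_le_card_group) (by rw [hH.out]; omega)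

/-- Bounding e_{k+1} by s_{k+1} turns the recursion into the Pascal rule for Gaussian binomials. -/
theorem numSubgroups_le_gaussTwo {G : Type*} [Group G] {n : ℕ} (hG : Nat.card G = 2 ^ n) (k : ℕ) :
    numSubgroups 2 G k ≤ gaussTwo n k := by
  have hfin : Finite G := Nat.finite_of_card_ne_zero (by rw [hG]; positivity)
  induction n generalizing G k with
  | zero =>
    cases k with
    | zero => simp [numSubgroups_zero]
    | succ k =>
      rw [numSubgroups_eq_zero]
      · exact Nat.zero_le _
      · rw [hG]
        exact Nat.pow_lt_pow_right one_lt_two k.succ_pos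
  | succ n ih =>
    cases k with
    | zero => simp [numSubgroups_zero]
    | succ k =>
      obtain ⟨z, hz, hz1, hz2⟩ := exists_central_involution hG
      obtain ⟨N, hN, hc, h2, -⟩ := exists_central_quotient hz hz1 hz2
      have hQ := two_mul_card_of_surjective (QuotientGroup.mk'_surjective N) h2
      rw [hG, pow_succ', Nat.mul_left_cancel_iff two_pos] at hQ
      have h1 := ih hQ k inferInstance
      have h3 := ih hQ (k + 1) inferInstance
      have h4 := numElemAb_le_numSubgroups (G := G ⧸ N) (k + 1)
      calc numSubgroups 2 G (k + 1)
          ≤ numSubgroups 2 (G ⧸ N) k +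
            2 ^ k * (numSubgroups 2 (G ⧸ N) (k + 1) + numElemAb (G ⧸ N) (k + 1)) :=
            numSubgroups_succ_le hc h2 k
        _ ≤ gaussTwo n k + 2 ^ k * (gaussTwo n (k + 1) + gaussTwo n (k + 1)) := by
            gcongr
            exact h4.trans h3
        _ = gaussTwo (n + 1) (k + 1) := by
            rw [gaussTwo_succ_succ, pow_succ]
            ring

/-! ### Elementary abelian subgroups through a unique central involution. -/

theorem ker_le_iff_of_mem_ker {G Q : Type*} [Group G] [Group Q] {f : G →* Q} {z : G}
    (hf : ∀ x, x ∈ f.ker ↔ x = 1 ∨ x = z) (H : Subgroup G) : f.ker ≤ H ↔ z ∈ H := by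
  refine ⟨fun h => h ((hf z).2 (Or.inr rfl)), fun h x hx => ?_⟩
  rcases (hf x).1 hx with rfl | rfl
  · exact one_mem H
  · exact h

/-- Factoring out x and then the image of z leaves a group of order 2^(c-2), to which the Gaussian
bound applies. -/
theorem ncard_containing_two_central_le {C : Type*} [Group C] {c : ℕ} (hC : Nat.card C = 2 ^ c)
    {x z : C} (hx : x ∈ Subgroup.center C) (hz : z ∈ Subgroup.center C) (hx1 : x ≠ 1)
    (hz1 : z ≠ 1) (hx2 : x * x = 1) (hz2 : z * z = 1) (hxz : z ≠ x) (k : ℕ) :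
    {E : Subgroup C | Nat.card E = 2 ^ (k + 2) ∧ x ∈ E ∧ z ∈ E}.ncard ≤ gaussTwo (c - 2) k := by
  have hfin : Finite C := Nat.finite_of_card_ne_zero (by rw [hC]; positivity)
  obtain ⟨N, hN, hc, h2, hker⟩ := exists_central_quotient hx hx1 hx2
  set f := QuotientGroup.mk' N with hf
  have hs : Function.Surjective f := QuotientGroup.mk'_surjective N
  have hw : f z ∈ Subgroup.center (C ⧸ N) := by
    rw [Subgroup.mem_center_iff]
    intro g
    obtain ⟨g, rfl⟩ := hs g
    rw [← map_mul, ← map_mul, Subgroup.mem_center_iff.1 hz g]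
  have hw1 : f z ≠ 1 := fun h => by
    rcases (hker z).1 h with h | h
    · exact hz1 h
    · exact hxz h
  have hw2 : f z * f z = 1 := by rw [← map_mul, hz2, map_one]
  obtain ⟨M, hM, hc', h2', hker'⟩ := exists_central_quotient hw hw1 hw2
  have hQ := two_mul_card_of_surjective hs h2
  have hR := two_mul_card_of_surjective (QuotientGroup.mk'_surjective M) h2'
  have hcard : Nat.card ((C ⧸ N) ⧸ M) = 2 ^ (c - 2) := by
    rw [hC, ← hR] at hQ
    rcases c with _ | _ | c
    · omega
    · omega
    · rw [pow_succ, pow_succ] at hQ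
      change _ = 2 ^ c
      omega
  refine le_trans ?_ ((ncard_ker_le_le h2' k).trans (numSubgroups_le_gaussTwo hcard k))
  refine Set.ncard_le_ncard_of_injOn (fun H => H.map f) ?_ ?_ (Set.toFinite _)
  · rintro E ⟨hE, hxE, hzE⟩
    refine ⟨card_map_eq_two_pow h2 ((ker_le_iff_of_mem_ker hker E).2 hxE) hE, ?_⟩
    exact (ker_le_iff_of_mem_ker hker' _).2 ⟨z, hzE, rfl⟩
  · exact injOn_map_of_ker_le.mono fun H hH => (ker_le_iff_of_mem_ker hker H).2 hH.2.1

/-- An elementary abelian E containing x lies in the centralizer of x. That is a proper subgroup, of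
order at most 2^(m+2), in which x and z are both central. -/
theorem ncard_elemAb_containing_le {G : Type*} [Group G] {m : ℕ} (hG : Nat.card G = 2 ^ (m + 3))
    {x z : G} (hx : x ∉ Subgroup.center G) (hz : z ∈ Subgroup.center G)
    (hz1 : z ≠ 1) (hx2 : x * x = 1) (hz2 : z * z = 1) (k : ℕ) :
    {E : Subgroup G | Nat.card E = 2 ^ (k + 2) ∧ (∀ y ∈ E, y * y = 1) ∧ x ∈ E ∧ z ∈ E}.ncard ≤
      gaussTwo m k := by
  have hfin : Finite G := Nat.finite_of_card_ne_zero (by rw [hG]; positivity)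
  set C : Subgroup G := Subgroup.centralizer {x} with hCdef
  have hxC : x ∈ C := Subgroup.mem_centralizer_singleton_iff.2 rfl
  have hzC : z ∈ C := Subgroup.mem_centralizer_singleton_iff.2
    (Subgroup.mem_center_iff.1 hz x).symm
  obtain ⟨c, hcm, hC⟩ := (Nat.dvd_prime_pow Nat.prime_two).1 (hG ▸ C.card_subgroup_dvd_card)
  have hc : c ≤ m + 2 := by
    rcases Nat.lt_or_ge c (m + 3) with h | h
    · omega
    · have htop : C = ⊤ := Subgroup.eq_top_of_card_eq C (by rw [hC, hG, le_antisymm hcm h])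
      refine absurd (Subgroup.mem_center_iff.2 fun g => ?_) hx
      have : g ∈ C := htop ▸ Subgroup.mem_top g
      exact Subgroup.mem_centralizer_singleton_iff.1 this
  have hle : ∀ E : Subgroup G, (∀ y ∈ E, y * y = 1) → x ∈ E → E ≤ C := by
    intro E hE hxE y hy
    rw [hCdef, Subgroup.mem_centralizer_singleton_iff]
    have hxi : x⁻¹ = x := inv_eq_of_mul_eq_one_left hx2
    have hyi : y⁻¹ = y := inv_eq_of_mul_eq_one_left (hE y hy)
    have := inv_eq_of_mul_eq_one_left (hE _ (E.mul_mem hy hxE))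
    rw [← this, mul_inv_rev, hxi, hyi]
  have key := ncard_containing_two_central_le hC (x := ⟨x, hxC⟩) (z := ⟨z, hzC⟩)
    (Subgroup.mem_center_iff.2 fun g =>
      Subtype.ext (Subgroup.mem_centralizer_singleton_iff.1 g.2))
    (Subgroup.mem_center_iff.2 fun g => Subtype.ext (Subgroup.mem_center_iff.1 hz g))
    (fun h => hx (by
      rw [show x = 1 from congrArg Subtype.val h]
      exact one_mem _)) (fun h => hz1 (congrArg Subtype.val h))
    (Subtype.ext hx2) (Subtype.ext hz2) (fun h => hx (by
      rwa [← show z = x from congrArg Subtype.val h])) k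
  refine le_trans ?_ (key.trans (gaussTwo_mono k (by omega : c - 2 ≤ m)))
  refine Set.ncard_le_ncard_of_injOn (fun E => E.subgroupOf C) ?_ ?_ (Set.toFinite _)
  · rintro E ⟨hE, hE2, hxE, hzE⟩
    refine ⟨?_, hxE, hzE⟩
    rw [← hE]
    exact Nat.card_congr (Subgroup.subgroupOfEquivOfLe (hle E hE2 hxE)).toEquiv
  · rintro E ⟨-, hE2, hxE, -⟩ E' ⟨-, hE2', hxE', -⟩ h
    have h1 := inf_eq_left.2 (hle E hE2 hxE)
    have h2 := inf_eq_left.2 (hle E' hE2' hxE')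
    rw [← h1, ← h2]
    exact Subgroup.subgroupOf_inj.1 h

/-- If more than three quarters of the elements square to `1`, all do. -/
theorem four_mul_ncard_mul_self_le {G : Type*} [Group G] [Finite G]
    (hne : ¬ ∀ x : G, x * x = 1) : 4 * {x : G | x * x = 1}.ncard ≤ 3 * Nat.card G := by
  by_contra hlt
  push Not at hlt
  set S : Set G := {x : G | x * x = 1} with hS
  -- Inclusion-exclusion for S and its translate: they share at least 2|S| - |G| elements, which is
  -- more than half of G.
  have hinter : ∀ g : G, 2 * S.ncard ≤ {h : G | h ∈ S ∧ g * h ∈ S}.ncard + Nat.card G := by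
    intro g
    have himg : ((Equiv.mulLeft g) ⁻¹' S).ncard = S.ncard :=
      Set.ncard_preimage_of_injective_subset_range (Equiv.mulLeft g).injective
        (by rw [Equiv.range_eq_univ]; exact Set.subset_univ S)
    have h1 := Set.ncard_union_add_ncard_inter S ((Equiv.mulLeft g) ⁻¹' S)
    have h2 : (S ∪ (Equiv.mulLeft g) ⁻¹' S).ncard ≤ Nat.card G := by
      rw [← Set.ncard_univ]
      exact Set.ncard_le_ncard (Set.subset_univ _) (Set.toFinite _)
    have h3 : S ∩ (Equiv.mulLeft g) ⁻¹' S = {h : G | h ∈ S ∧ g * h ∈ S} := rfl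
    rw [himg, h3] at h1
    omega
  -- If g, h and gh all square to 1, then g and h commute. So the centralizer of g has more than
  -- half the elements and is all of G.
  have hcent : ∀ g ∈ S, g ∈ Subgroup.center G := by
    intro g hg
    have hsub : {h : G | h ∈ S ∧ g * h ∈ S} ⊆ (Subgroup.centralizer {g} : Subgroup G) := by
      rintro h ⟨hh, hgh⟩
      rw [SetLike.mem_coe, Subgroup.mem_centralizer_singleton_iff]
      have hgi : g⁻¹ = g := inv_eq_of_mul_eq_one_left hg
      have hhi : h⁻¹ = h := inv_eq_of_mul_eq_one_left hh
      have := inv_eq_of_mul_eq_one_left hgh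
      rw [← this, mul_inv_rev, hhi, hgi]
    have hcard := Set.ncard_le_ncard hsub (Set.toFinite _)
    rw [← Nat.card_coe_set_eq (Subgroup.centralizer {g} : Set G)] at hcard
    have hc2 : Nat.card G < 2 * Nat.card (Subgroup.centralizer {g}) := by
      have := hinter g
      have : {h : G | h ∈ S ∧ g * h ∈ S}.ncard ≤ Nat.card (Subgroup.centralizer {g}) := hcard
      omega
    have hidx := (Subgroup.centralizer {g}).card_mul_index
    have htop : Subgroup.centralizer {g} = ⊤ := by
      rw [← Subgroup.index_eq_one]
      have hpos : (Subgroup.centralizer {g}).index ≠ 0 := Subgroup.index_ne_zero_of_finite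
      by_contra hne1
      have : 2 ≤ (Subgroup.centralizer {g}).index := by omega
      nlinarith
    refine Subgroup.mem_center_iff.2 fun y => ?_
    have : y ∈ Subgroup.centralizer {g} := htop ▸ Subgroup.mem_top y
    exact Subgroup.mem_centralizer_singleton_iff.1 this
  refine hne fun g => ?_
  -- An arbitrary g now has a central h in S with gh in S, which forces g to square to 1.
  have hpos : 0 < {h : G | h ∈ S ∧ g * h ∈ S}.ncard := by
    have := hinter g
    omega
  obtain ⟨h, hh, hgh⟩ := (Set.ncard_pos (Set.toFinite _)).1 hpos
  have hcomm := Subgroup.mem_center_iff.1 (hcent h hh) g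
  have : g * h * (g * h) = g * g * (h * h) := Commute.mul_mul_mul_comm hcomm.symm _ _
  have hgh' : g * h * (g * h) = 1 := hgh
  have hh' : h * h = 1 := hh
  rwa [hgh', hh', mul_one, eq_comm] at this

/-- Double counting of pairs x ∈ E, with E elementary abelian of order 2^(k+2) containing z, and x ≠
1, z squaring to 1. By uniqueness of z every such x is noncentral. -/
theorem numElemAbOver_succ_le_maxElemAb {G Q : Type*} [Group G] [Group Q] {f : G →* Q} {m : ℕ}
    (hG : Nat.card G = 2 ^ (m + 3)) (hne : ¬ ∀ x : G, x * x = 1) {z : G}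
    (hz : z ∈ Subgroup.center G) (hz1 : z ≠ 1) (hz2 : z * z = 1)
    (hf : ∀ x, x ∈ f.ker ↔ x = 1 ∨ x = z)
    (huniq : ∀ x ∈ Subgroup.center G, x * x = 1 → x = 1 ∨ x = z) (k : ℕ) :
    numElemAbOver f (k + 1) ≤ maxElemAb (m + 2) (k + 1) := by
  classical
  have hfin : Finite G := Nat.finite_of_card_ne_zero (by rw [hG]; positivity)
  have : Fintype G := Fintype.ofFinite G
  have hTfin : {H : Subgroup G | Nat.card H = 2 ^ (k + 1 + 1) ∧ f.ker ≤ H ∧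
      ∀ x ∈ H, x * x = 1}.Finite := Set.toFinite _
  have hpair : ({1, z} : Finset G).card = 2 := Finset.card_pair hz1.symm
  let I : Finset G := Finset.univ.filter (fun x => x * x = 1) \ {1, z}
  -- Three quarters of 2^(m+3) is 6 · 2^m, and the elements 1 and z are removed.
  have hI : I.card ≤ 2 * (3 * 2 ^ m - 1) := by
    have h1 : I.card = (Finset.univ.filter fun x : G => x * x = 1).card - 2 := by
      rw [Finset.card_sdiff_of_subset, hpair]
      intro x hx
      rcases Finset.mem_insert.1 hx with rfl | hx
      · simp
      · rw [Finset.mem_singleton.1 hx]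
        simp [hz2]
    have h2 := four_mul_ncard_mul_self_le hne
    have h3 : {x : G | x * x = 1}.ncard = (Finset.univ.filter fun x : G => x * x = 1).card := by
      rw [← Set.ncard_coe_finset]
      simp
    rw [hG, h3, pow_add] at h2
    omega
  have hdc := Finset.card_mul_le_card_mul (s := hTfin.toFinset) (t := I)
    (fun (E : Subgroup G) x => x ∈ E) (m := 2 ^ (k + 2) - 2) (n := gaussTwo m k) ?_ ?_
  · have hT : hTfin.toFinset.card = numElemAbOver f (k + 1) :=
      (Set.ncard_eq_toFinset_card _ hTfin).symm
    rw [hT] at hdc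
    have h1 := hdc.trans (Nat.mul_le_mul_right _ hI)
    have h2 := mul_gaussTwo_le_mul_maxElemAb m k
    have hp : 1 ≤ 2 ^ m := Nat.one_le_two_pow
    have hp' : 2 ≤ 2 ^ (k + 1) := by
      rw [pow_succ]
      have : 1 ≤ 2 ^ k := Nat.one_le_two_pow
      omega
    have e : 2 ^ (k + 2) - 2 = 2 * (2 ^ (k + 1) - 1) := by
      rw [pow_succ 2 (k + 1)]
      omega
    rw [e] at h1
    zify [show 1 ≤ 2 ^ (k + 1) by omega, show 1 ≤ 3 * 2 ^ m by omega] at h1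
    have h3 : (0 : ℤ) < 2 ^ (k + 1) - 1 := by
      zify at hp'
      linarith
    zify
    refine le_of_mul_le_mul_left ?_ h3
    linarith
  · intro E hE
    have hE' := hTfin.mem_toFinset.1 hE
    obtain ⟨hcard, hker, hE2⟩ := hE'
    have h1 : (Finset.univ.filter fun x : G => x ∈ E).card = 2 ^ (k + 2) := by
      rw [← hcard, Nat.card_eq_fintype_card, Fintype.card_subtype]
    have h2 : Finset.bipartiteAbove (fun (E : Subgroup G) x => x ∈ E) I E =
        (Finset.univ.filter fun x : G => x ∈ E) \ {1, z} := by
      ext x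
      simp only [Finset.mem_bipartiteAbove, I, Finset.mem_sdiff, Finset.mem_filter,
        Finset.mem_univ, true_and]
      constructor
      · exact fun h => ⟨h.2, h.1.2⟩
      · exact fun h => ⟨⟨hE2 x h.1, h.2⟩, h.1⟩
    rw [h2, Finset.card_sdiff_of_subset, hpair, h1]
    intro x hx
    rcases Finset.mem_insert.1 hx with rfl | hx
    · simp
    · rw [Finset.mem_singleton.1 hx]
      simpa using (ker_le_iff_of_mem_ker hf E).1 hker
  · intro x hx
    simp only [I, Finset.mem_sdiff, Finset.mem_filter, Finset.mem_univ, true_and,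
      Finset.mem_insert, Finset.mem_singleton] at hx
    have hxc : x ∉ Subgroup.center G := fun h => hx.2 (huniq x h hx.1)
    refine le_trans ?_ (ncard_elemAb_containing_le hG hxc hz hz1 hx.1 hz2 k)
    rw [← Set.ncard_coe_finset]
    refine Set.ncard_le_ncard ?_ (Set.toFinite _)
    intro E hE
    have hE' := (Finset.mem_bipartiteBelow _).1 (Finset.mem_coe.1 hE)
    obtain ⟨hcard, hker, hE2⟩ := hTfin.mem_toFinset.1 hE'.1
    exact ⟨hcard, hE2, hE'.2, (ker_le_iff_of_mem_ker hf E).1 hker⟩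

/-! ### The upper bound by induction on the order. -/

theorem numElemAbOver_one_eq_zero_of_card_four {G Q : Type*} [Group G] [Group Q] [Finite G]
    {f : G →* Q} (hG : Nat.card G = 2 ^ 2) (hne : ¬ ∀ x : G, x * x = 1) (k : ℕ) :
    numElemAbOver f (k + 1) = 0 := by
  rw [numElemAbOver, Set.ncard_eq_zero (Set.toFinite _), Set.eq_empty_iff_forall_notMem]
  rintro E ⟨hE, -, hE2⟩
  have hle : Nat.card G ≤ Nat.card E := by
    rw [hG, hE]
    exact Nat.pow_le_pow_right two_pos (by omega)
  have htop := Subgroup.eq_top_of_le_card E hle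
  exact hne fun x => hE2 x (htop ▸ Subgroup.mem_top x)

/-- The case in which every central quotient by an involution is elementary abelian. -/
theorem bounds_of_forall_quotient_elemAb {G : Type*} [Group G] {n : ℕ}
    (hG : Nat.card G = 2 ^ (n + 2)) (hne : ¬ ∀ x : G, x * x = 1)
    (h : ∀ z ∈ Subgroup.center G, z ≠ 1 → z * z = 1 → ∀ y : G, y * y = 1 ∨ y * y = z) (k : ℕ) :
    numSubgroups 2 G (k + 1) ≤ maxSubgroups (n + 2) (k + 1) ∧
      numElemAb G (k + 1) ≤ maxElemAb (n + 2) (k + 1) := by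
  have hfin : Finite G := Nat.finite_of_card_ne_zero (by rw [hG]; positivity)
  obtain ⟨z, hz, hz1, hz2⟩ := exists_central_involution hG
  obtain ⟨N, hN, hc, h2, hker⟩ := exists_central_quotient hz hz1 hz2
  have hs : Function.Surjective (QuotientGroup.mk' N) := QuotientGroup.mk'_surjective N
  have hQ := two_mul_card_of_surjective hs h2
  rw [hG, pow_succ', Nat.mul_left_cancel_iff two_pos] at hQ
  have hQ2 : ∀ x : G ⧸ N, x * x = 1 := fun x => by
    obtain ⟨y, rfl⟩ := hs x
    rw [← map_mul]
    exact (hker _).2 (h z hz hz1 hz2 y)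
  -- A nontrivial square, which exists by `hne`, would have to equal every central involution.
  have huniq : ∀ x ∈ Subgroup.center G, x * x = 1 → x = 1 ∨ x = z := by
    intro x hx hx2
    by_contra hcon
    push Not at hcon
    refine hne fun y => ?_
    rcases h z hz hz1 hz2 y with h1 | h1
    · exact h1
    · rcases h x hx hcon.1 hx2 y with h2 | h2
      · exact h2
      · exact absurd (h2.symm.trans h1) hcon.2
  have hT : ∀ j, numElemAbOver (QuotientGroup.mk' N) j ≤ maxElemAb (n + 1) j := by
    intro j
    cases j with
    | zero =>
      rw [maxElemAb_zero]
      exact (numElemAbOver_le h2 0).trans (numElemAb_zero _).le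
    | succ j =>
      cases n with
      | zero =>
        rw [numElemAbOver_one_eq_zero_of_card_four hG hne]
        exact Nat.zero_le _
      | succ m => exact numElemAbOver_succ_le_maxElemAb hG hne hz hz1 hz2 hker huniq j
  constructor
  · refine (numSubgroups_succ_le_of_elemAb hs hc h2 hQ2 k).trans ?_
    exact Nat.add_le_add (numSubgroups_le_gaussTwo hQ k) (Nat.mul_le_mul_left _ (hT (k + 1)))
  · refine (numElemAb_succ_le hs hc h2 k).trans (le_trans ?_ (le_maxElemAb_succ n k))
    exact Nat.add_le_add (hT k) (Nat.mul_le_mul_left _ (hT (k + 1)))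

theorem numSubgroups_le_and_numElemAb_le {G : Type*} [Group G] {n : ℕ}
    (hG : Nat.card G = 2 ^ (n + 2)) (hne : ¬ ∀ x : G, x * x = 1) (k : ℕ) :
    numSubgroups 2 G k ≤ maxSubgroups (n + 2) k ∧ numElemAb G k ≤ maxElemAb (n + 2) k := by
  have hfin : Finite G := Nat.finite_of_card_ne_zero (by rw [hG]; positivity)
  induction n generalizing G k with
  | zero =>
    cases k with
    | zero => simp [numSubgroups_zero, numElemAb_zero, maxSubgroups]
    | succ k =>
      refine bounds_of_forall_quotient_elemAb hG hne (fun z hz hz1 hz2 y => ?_) k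
      obtain ⟨N, hN, hc, h2, hker⟩ := exists_central_quotient hz hz1 hz2
      have hQ := two_mul_card_of_surjective (QuotientGroup.mk'_surjective N) h2
      rw [hG] at hQ
      -- At order 4 every central quotient by an involution has order 2, so the exceptional case
      -- always applies.
      have hQ2 : Nat.card (G ⧸ N) = 2 := by omega
      have := pow_card_eq_one' (x := QuotientGroup.mk' N y)
      rw [hQ2, pow_two, ← map_mul] at this
      exact (hker _).1 this
  | succ n ih =>
    cases k with
    | zero => simp [numSubgroups_zero, numElemAb_zero, maxSubgroups]
    | succ k =>
      by_cases h : ∀ z ∈ Subgroup.center G, z ≠ 1 → z * z = 1 → ∀ y : G, y * y = 1 ∨ y * y = z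
      · exact bounds_of_forall_quotient_elemAb hG hne h k
      push Not at h
      obtain ⟨z, hz, hz1, hz2, y, hy1, hyz⟩ := h
      obtain ⟨N, hN, hc, h2, hker⟩ := exists_central_quotient hz hz1 hz2
      have hs : Function.Surjective (QuotientGroup.mk' N) := QuotientGroup.mk'_surjective N
      have hQ := two_mul_card_of_surjective hs h2
      rw [hG, show n + 1 + 2 = n + 2 + 1 from rfl, pow_succ',
        Nat.mul_left_cancel_iff two_pos] at hQ
      have hQne : ¬ ∀ x : G ⧸ N, x * x = 1 := fun hall => by
        have := hall (QuotientGroup.mk' N y)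
        rw [← map_mul] at this
        rcases (hker _).1 this with h | h
        · exact hy1 h
        · exact hyz h
      have hb := fun j => ih hQ hQne j inferInstance
      constructor
      · refine (numSubgroups_succ_le hc h2 k).trans (le_trans ?_ (le_maxSubgroups_succ n k))
        exact Nat.add_le_add (hb k).1
          (Nat.mul_le_mul_left _ (Nat.add_le_add (hb (k + 1)).1 (hb (k + 1)).2))
      · refine (numElemAb_succ_le hs hc h2 k).trans (le_trans ?_ (le_maxElemAb_succ (n + 1) k))
        exact Nat.add_le_add ((numElemAbOver_le h2 k).trans (hb k).2)
          (Nat.mul_le_mul_left _ ((numElemAbOver_le h2 (k + 1)).trans (hb (k + 1)).2))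

/-! ### Lower bounds for a direct product with a group of order 2. -/

section DirectProduct

variable {H C : Type*} [Group H] [Group C]

theorem prod_top_injective :
    Function.Injective fun K : Subgroup H => K.prod (⊤ : Subgroup C) := by
  intro K K' h
  ext x
  have := SetLike.ext_iff.1 h (x, 1)
  simpa [Subgroup.mem_prod] using this

/-- The graph of a homomorphism defined on a subgroup. -/
def homGraph (K : Subgroup H) (χ : K →* C) : Subgroup (H × C) := (K.subtype.prod χ).range

theorem mem_homGraph {K : Subgroup H} {χ : K →* C} {p : H × C} :
    p ∈ homGraph K χ ↔ ∃ h : p.1 ∈ K, χ ⟨p.1, h⟩ = p.2 := by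
  constructor
  · rintro ⟨x, rfl⟩
    exact ⟨x.2, rfl⟩
  · rintro ⟨h, hp⟩
    exact ⟨⟨p.1, h⟩, Prod.ext rfl hp⟩

theorem card_homGraph (K : Subgroup H) (χ : K →* C) : Nat.card (homGraph K χ) = Nat.card K :=
  (Nat.card_congr (MonoidHom.ofInjective (f := K.subtype.prod χ) fun _ _ h =>
    Subtype.ext (congrArg Prod.fst h)).toEquiv).symm

theorem homGraph_injective :
    Function.Injective fun p : (K : Subgroup H) × (K →* C) => homGraph p.1 p.2 := by
  rintro ⟨K, χ⟩ ⟨K', χ'⟩ h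
  have hmem : ∀ p : H × C, p ∈ homGraph K χ ↔ p ∈ homGraph K' χ' := fun p =>
    SetLike.ext_iff.1 h p
  have hK : K = K' := by
    ext x
    constructor
    · intro hx
      obtain ⟨h', -⟩ := mem_homGraph.1 ((hmem (x, χ ⟨x, hx⟩)).1 (mem_homGraph.2 ⟨hx, rfl⟩))
      exact h'
    · intro hx
      obtain ⟨h', -⟩ := mem_homGraph.1 ((hmem (x, χ' ⟨x, hx⟩)).2 (mem_homGraph.2 ⟨hx, rfl⟩))
      exact h'
  subst hK
  congr 1
  ext x
  obtain ⟨_, h'⟩ := mem_homGraph.1 ((hmem (x, χ x)).1 (mem_homGraph.2 ⟨x.2, rfl⟩))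
  exact h'.symm

variable [Finite H] [Finite C]

/-- The full products contain some (1, c) with c ≠ 1 and the graphs contain none, so the two
families are disjoint. -/
theorem ncard_add_sum_card_monoidHom_le (A : Set (Subgroup H)) (B : Finset (Subgroup H))
    (T : Set (Subgroup (H × C))) [Nontrivial C] (hA : ∀ K ∈ A, K.prod ⊤ ∈ T)
    (hB : ∀ K ∈ B, ∀ χ : K →* C, homGraph K χ ∈ T) :
    A.ncard + ∑ K ∈ B, Nat.card (K →* C) ≤ T.ncard := by
  classical
  have hfin : ∀ K : Subgroup H, Finite (K →* C) := fun K =>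
    Finite.of_injective _ DFunLike.coe_injective
  have hfint : ∀ K : Subgroup H, Fintype (K →* C) := fun K => Fintype.ofFinite _
  let g : (K : Subgroup H) × (K →* C) → Subgroup (H × C) := fun p => homGraph p.1 p.2
  let S : Finset ((K : Subgroup H) × (K →* C)) := B.sigma fun K => Finset.univ
  have hS : ∑ K ∈ B, Nat.card (K →* C) = (g '' (S : Set _)).ncard := by
    rw [Set.ncard_image_of_injective _ homGraph_injective, Set.ncard_coe_finset,
      Finset.card_sigma]
    exact Finset.sum_congr rfl fun K _ => by rw [Nat.card_eq_fintype_card, Finset.card_univ]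
  have hdisj : Disjoint ((fun K : Subgroup H => K.prod (⊤ : Subgroup C)) '' A)
      (g '' (S : Set _)) := by
    rw [Set.disjoint_left]
    rintro _ ⟨K, -, rfl⟩ ⟨⟨K', χ⟩, -, h⟩
    obtain ⟨c, hc⟩ := exists_ne (1 : C)
    have h1 : ((1 : H), c) ∈ homGraph K' χ := by
      change _ ∈ g ⟨K', χ⟩
      rw [h]
      exact Subgroup.mem_prod.2 ⟨one_mem _, Subgroup.mem_top _⟩
    obtain ⟨h', h''⟩ := mem_homGraph.1 h1
    exact hc (h''.symm.trans (map_one χ))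
  rw [hS, ← Set.ncard_image_of_injective A (prod_top_injective (C := C)),
    ← Set.ncard_union_eq hdisj (Set.toFinite _) (Set.toFinite _)]
  refine Set.ncard_le_ncard (Set.union_subset ?_ ?_) (Set.toFinite _)
  · rintro _ ⟨K, hK, rfl⟩
    exact hA K hK
  · rintro _ ⟨⟨K, χ⟩, hK, rfl⟩
    exact hB K (Finset.mem_sigma.1 (Finset.mem_coe.1 hK)).1 χ

end DirectProduct

instance nontrivial_int_units : Nontrivial ℤˣ := ⟨1, -1, by decide⟩

theorem card_prod_top {H : Type*} [Group H] [Finite H] {k : ℕ} {K : Subgroup H}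
    (hK : Nat.card K = 2 ^ k) : Nat.card (K.prod (⊤ : Subgroup ℤˣ)) = 2 ^ (k + 1) := by
  rw [Nat.card_congr (Subgroup.prodEquiv K ⊤).toEquiv, Nat.card_prod, hK, Subgroup.card_top,
    pow_succ]
  simp

theorem le_numElemAb_prod {H : Type*} [Group H] [Finite H] (k : ℕ) :
    numElemAb H k + 2 ^ (k + 1) * numElemAb H (k + 1) ≤ numElemAb (H × ℤˣ) (k + 1) := by
  have hfin : {K : Subgroup H | Nat.card K = 2 ^ (k + 1) ∧ ∀ x ∈ K, x * x = 1}.Finite :=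
    Set.toFinite _
  refine le_trans (Nat.add_le_add_left (le_of_eq ?_) _)
    (ncard_add_sum_card_monoidHom_le (C := ℤˣ) _ hfin.toFinset _ ?_ ?_)
  · rw [Finset.sum_congr rfl (g := fun _ => 2 ^ (k + 1)), Finset.sum_const, smul_eq_mul, mul_comm,
      ← Set.ncard_eq_toFinset_card _ hfin, numElemAb]
    intro K hK
    obtain ⟨hK, hK2⟩ := hfin.mem_toFinset.1 hK
    rw [card_monoidHom_units_of_mul_self fun x => Subtype.ext (hK2 x x.2), hK]
  · rintro K ⟨hK, hK2⟩
    exact ⟨card_prod_top hK, fun x hx =>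
      Prod.ext (hK2 _ (Subgroup.mem_prod.1 hx).1) (Int.units_mul_self _)⟩
  · intro K hK χ
    obtain ⟨hK, hK2⟩ := hfin.mem_toFinset.1 hK
    refine ⟨(card_homGraph K χ).trans hK, fun x hx => ?_⟩
    obtain ⟨h, -⟩ := mem_homGraph.1 hx
    exact Prod.ext (hK2 _ h) (Int.units_mul_self _)

/-- Squares of any K lie in a normal subgroup of order at most 2, so K has at least |K|/2
homomorphisms to ±1, and |K| if elementary abelian. This matches the loss in the upper recursion. -/
theorem le_numSubgroups_prod {H : Type*} [Group H] [Finite H] (N : Subgroup H) [N.Normal]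
    (hN : Nat.card N ≤ 2) (hsq : ∀ x : H, x * x ∈ N) (k : ℕ) :
    numSubgroups 2 H k + 2 ^ k * (numSubgroups 2 H (k + 1) + numElemAb H (k + 1)) ≤
      numSubgroups 2 (H × ℤˣ) (k + 1) := by
  classical
  have hfin : {K : Subgroup H | Nat.card K = 2 ^ (k + 1)}.Finite := Set.toFinite _
  rw [numSubgroups_eq_ncard H k, numSubgroups_eq_ncard (H × ℤˣ)]
  refine le_trans (Nat.add_le_add_left ?_ _)
    (ncard_add_sum_card_monoidHom_le (C := ℤˣ) _ hfin.toFinset _ ?_ ?_)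
  · have hle : ∀ K ∈ hfin.toFinset, 2 ^ k * (1 + if ∀ x ∈ K, x * x = 1 then 1 else 0) ≤
        Nat.card (K →* ℤˣ) := by
      intro K hK
      have hK' : Nat.card K = 2 ^ (k + 1) := hfin.mem_toFinset.1 hK
      split_ifs with h
      · rw [card_monoidHom_units_of_mul_self fun x => Subtype.ext (h x x.2), hK', pow_succ]
      · have hcard : Nat.card (N.subgroupOf K) ≤ 2 :=
          le_trans (Nat.card_le_card_of_injective
            (fun x : N.subgroupOf K => (⟨x.1.1, x.2⟩ : N)) fun x y hxy =>
              Subtype.ext (Subtype.ext (show x.1.1 = y.1.1 from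
                congrArg (fun t : N => (t : H)) hxy))) hN
        have := card_le_two_mul_card_monoidHom_units (K := K) (N.subgroupOf K) hcard
          fun x => hsq x
        rw [hK', pow_succ] at this
        omega
    refine le_trans (le_of_eq ?_) (Finset.sum_le_sum hle)
    rw [← Finset.mul_sum, Finset.sum_add_distrib, Finset.sum_const, smul_eq_mul, mul_one,
      ← Finset.card_filter, numSubgroups_eq_ncard, Set.ncard_eq_toFinset_card _ hfin, numElemAb,
      ← Set.ncard_coe_finset (Finset.filter _ _)]
    congr 3
    ext K
    simp
  · exact fun K hK => card_prod_top hK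
  · exact fun K hK χ => (card_homGraph K χ).trans (hfin.mem_toFinset.1 hK)

theorem numSubgroups_congr {G H : Type*} [Group G] [Group H] (e : G ≃* H) (k : ℕ) :
    numSubgroups 2 G k = numSubgroups 2 H k :=
  Nat.card_congr (e.mapSubgroup.toEquiv.subtypeEquiv fun K => by
    rw [Nat.card_congr (K.equivMapOfInjective e.toMonoidHom e.injective).toEquiv]
    rfl)

theorem numElemAb_congr_le {G H : Type*} [Group G] [Group H] [Finite H] (e : G ≃* H) (k : ℕ) :
    numElemAb G k ≤ numElemAb H k := by
  refine Set.ncard_le_ncard_of_injOn (fun K => K.map e.toMonoidHom) ?_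
    (Subgroup.map_injective e.injective).injOn (Set.toFinite _)
  rintro K ⟨hK, hK2⟩
  refine ⟨?_, ?_⟩
  · rw [← hK, Nat.card_congr (K.equivMapOfInjective e.toMonoidHom e.injective).toEquiv]
  · rintro _ ⟨x, hx, rfl⟩
    rw [← map_mul, hK2 x hx, map_one]

/-! ### The extremal group D_8 × C_2^m. -/

/-- A subgroup given by an explicit finite set of elements. -/
def subgroupOfFinset {G : Type*} [Group G] (s : Finset G) (h1 : 1 ∈ s)
    (hm : ∀ a ∈ s, ∀ b ∈ s, a * b ∈ s) (hi : ∀ a ∈ s, a⁻¹ ∈ s) : Subgroup G where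
  carrier := s
  one_mem' := h1
  mul_mem' := fun ha hb => hm _ ha _ hb
  inv_mem' := fun ha => hi _ ha

theorem le_ncard_subgroups {G : Type*} [Group G] [Finite G] {n k : ℕ} (s : Fin n → Finset G)
    (hs : Function.Injective s) (h1 : ∀ i, 1 ∈ s i) (hm : ∀ i, ∀ a ∈ s i, ∀ b ∈ s i, a * b ∈ s i)
    (hi : ∀ i, ∀ a ∈ s i, a⁻¹ ∈ s i) (hc : ∀ i, (s i).card = 2 ^ k) (P : Subgroup G → Prop)
    (hP : ∀ i, P (subgroupOfFinset (s i) (h1 i) (hm i) (hi i))) :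
    n ≤ {H : Subgroup G | Nat.card H = 2 ^ k ∧ P H}.ncard := by
  let g : Fin n → Subgroup G := fun i => subgroupOfFinset (s i) (h1 i) (hm i) (hi i)
  have hg : Function.Injective g := fun i j h => hs (Finset.coe_injective (congrArg
    (fun K : Subgroup G => (K : Set G)) h))
  have : (Set.range g).ncard = n := by
    rw [← Set.image_univ, Set.ncard_image_of_injective _ hg, Set.ncard_univ, Nat.card_fin]
  rw [← this]
  refine Set.ncard_le_ncard ?_ (Set.toFinite _)
  rintro _ ⟨i, rfl⟩
  refine ⟨?_, hP i⟩
  rw [← hc i]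
  exact (Nat.card_coe_set_eq ((s i : Finset G) : Set G)).trans (Set.ncard_coe_finset _)

theorem five_le_numElemAb_dihedral : 5 ≤ numElemAb (DihedralGroup 4) 1 := by
  refine le_ncard_subgroups ![{1, .r 2}, {1, .sr 0}, {1, .sr 1}, {1, .sr 2}, {1, .sr 3}]
    ?_ ?_ ?_ ?_ ?_ _ ?_
  · decide
  · decide
  · decide
  · decide
  · decide
  · intro i
    change ∀ x ∈ (_ : Finset _), x * x = 1
    revert i
    decide

theorem two_le_numElemAb_dihedral : 2 ≤ numElemAb (DihedralGroup 4) 2 := by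
  refine le_ncard_subgroups ![{1, .r 2, .sr 0, .sr 2}, {1, .r 2, .sr 1, .sr 3}]
    ?_ ?_ ?_ ?_ ?_ _ ?_
  · decide
  · decide
  · decide
  · decide
  · decide
  · intro i
    change ∀ x ∈ (_ : Finset _), x * x = 1
    revert i
    decide

theorem three_le_numSubgroups_dihedral : 3 ≤ numSubgroups 2 (DihedralGroup 4) 2 := by
  have := le_ncard_subgroups (k := 2) (![{1, .r 2, .sr 0, .sr 2}, {1, .r 2, .sr 1, .sr 3},
    {1, .r 1, .r 2, .r 3}] : Fin 3 → Finset (DihedralGroup 4))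
    (by decide) (by decide) (by decide) (by decide) (by decide) (fun _ => True) (fun _ => trivial)
  simpa [numSubgroups_eq_ncard] using this

/-- For k = 0, 1, 2, 3 the required values are 1, 5, 3, 1 for all subgroups and 1, 5, 2, 0 for
elementary abelian ones. -/
theorem maxSubgroups_le_dihedral (k : ℕ) :
    maxSubgroups 3 k ≤ numSubgroups 2 (DihedralGroup 4) k ∧
      maxElemAb 3 k ≤ numElemAb (DihedralGroup 4) k := by
  rcases k with _ | _ | _ | _ | k
  · exact ⟨(numSubgroups_zero _).ge, (numElemAb_zero _).ge⟩
  · exact ⟨five_le_numElemAb_dihedral.trans (numElemAb_le_numSubgroups 1),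
      five_le_numElemAb_dihedral⟩
  · exact ⟨three_le_numSubgroups_dihedral, two_le_numElemAb_dihedral⟩
  · refine ⟨?_, Nat.zero_le _⟩
    rw [numSubgroups_eq_ncard]
    refine (Set.ncard_pos (Set.toFinite _)).2 ⟨⊤, ?_⟩
    rw [Set.mem_ofPred_eq, Subgroup.card_top, DihedralGroup.nat_card]
    rfl
  · simp [maxSubgroups, maxElemAb, gaussTwo_succ_succ]

/-- Splitting off the first coordinate of `C_2 ^ (m + 1)`. -/
noncomputable def elemAbTwoSuccEquiv (m : ℕ) : ElemAbTwo (m + 1) ≃* ElemAbTwo m × ℤˣ :=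
  have : Fact (Nat.Prime 2) := ⟨Nat.prime_two⟩
  let c : Multiplicative (ZMod 2) ≃* ℤˣ := mulEquivOfPrimeCardEq (p := 2) (by simp) (by simp)
  { toFun := fun v => (Fin.tail v, c (v 0))
    invFun := fun p => Fin.cons (c.symm p.2) p.1
    left_inv := fun v => by simp
    right_inv := fun p => by simp
    map_mul' := fun v w => by
      refine Prod.ext rfl ?_
      simp }

theorem numElemAb_congr {G H : Type*} [Group G] [Group H] [Finite G] [Finite H] (e : G ≃* H)
    (k : ℕ) : numElemAb G k = numElemAb H k :=
  le_antisymm (numElemAb_congr_le e k) (numElemAb_congr_le e.symm k)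

theorem maxSubgroups_le_dihedral_prod (m k : ℕ) :
    maxSubgroups (m + 3) k ≤ numSubgroups 2 (DihedralGroup 4 × ElemAbTwo m) k ∧
      maxElemAb (m + 3) k ≤ numElemAb (DihedralGroup 4 × ElemAbTwo m) k := by
  induction m generalizing k with
  | zero =>
    have e : DihedralGroup 4 × ElemAbTwo 0 ≃* DihedralGroup 4 := MulEquiv.prodUnique
    rw [numSubgroups_congr e, numElemAb_congr e]
    exact maxSubgroups_le_dihedral k
  | succ m ih =>
    have e : DihedralGroup 4 × ElemAbTwo (m + 1) ≃* (DihedralGroup 4 × ElemAbTwo m) × ℤˣ :=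
      ((MulEquiv.refl _).prodCongr (elemAbTwoSuccEquiv m)).trans MulEquiv.prodAssoc.symm
    rw [numSubgroups_congr e, numElemAb_congr e]
    cases k with
    | zero => simp [numSubgroups_zero, numElemAb_zero, maxSubgroups]
    | succ k =>
      constructor
      -- The rotation subgroup of order 2 contains all squares of D_8, and the other factor has only
      -- trivial squares.
      · let Z : Subgroup (DihedralGroup 4) :=
          subgroupOfFinset {1, .r 2} (by decide) (by decide) (by decide)
        have hZmem : ∀ x, x ∈ Z ↔ x ∈ ({1, .r 2} : Finset (DihedralGroup 4)) := fun x => Iff.rfl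
        have hZ : Z.Normal := ⟨by simp only [hZmem]; decide⟩
        have hsq : ∀ x : DihedralGroup 4, x * x ∈ Z := by simp only [hZmem]; decide
        have hcard : Nat.card Z = 2 := (Nat.card_coe_set_eq _).trans
          (Set.ncard_coe_finset ({1, .r 2} : Finset (DihedralGroup 4)))
        have hN : Nat.card (Z.prod (⊥ : Subgroup (ElemAbTwo m))) ≤ 2 := by
          rw [Nat.card_congr (Subgroup.prodEquiv Z ⊥).toEquiv, Nat.card_prod, hcard,
            Subgroup.card_bot]
        have hNsq : ∀ x : DihedralGroup 4 × ElemAbTwo m,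
            x * x ∈ Z.prod (⊥ : Subgroup (ElemAbTwo m)) := fun x => by
          refine Subgroup.mem_prod.2 ⟨hsq x.1, Subgroup.mem_bot.2 (funext fun i => ?_)⟩
          exact (by decide : ∀ a : Multiplicative (ZMod 2), a * a = 1) (x.2 i)
        refine le_trans ?_ (le_numSubgroups_prod _ hN hNsq k)
        rw [show m + 1 + 3 = m + 4 from rfl, maxSubgroups_succ]
        exact Nat.add_le_add (ih k).1
          (Nat.mul_le_mul_left _ (Nat.add_le_add (ih (k + 1)).1 (ih (k + 1)).2))
      · refine le_trans ?_ (le_numElemAb_prod k)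
        rw [maxElemAb_succ]
        exact Nat.add_le_add (ih k).2 (Nat.mul_le_mul_left _ (ih (k + 1)).2)

theorem theorem1p1 {G : Type*} [Group G] (n : ℕ) (hn : 3 ≤ n)
    (hG : Nat.card G = 2 ^ n) (hne : ¬ IsElemAbelian 2 G) (k : ℕ) (hk : k ≤ n) :
    numSubgroups 2 G k ≤ numSubgroups 2 (DihedralGroup 4 × ElemAbTwo (n - 3)) k := by
  obtain ⟨m, rfl⟩ := Nat.exists_eq_add_of_le' hn
  rw [Nat.add_sub_cancel]
  have hne' : ¬ ∀ x : G, x * x = 1 := fun h => hne ⟨fun x y => by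
    have hx : x⁻¹ = x := inv_eq_of_mul_eq_one_left (h x)
    have hy : y⁻¹ = y := inv_eq_of_mul_eq_one_left (h y)
    rw [← inv_eq_of_mul_eq_one_left (h (x * y)), mul_inv_rev, hx, hy],
    fun x => by rw [pow_two, h x]⟩
  exact (numSubgroups_le_and_numElemAb_le (n := m + 1) hG hne' k).1.trans
    (maxSubgroups_le_dihedral_prod m k).1
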